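/- For $n\ge 2$ and $p=p(n)\in[0,1]$, let $G(n,p)$ be the Erdős–Rényi random graph on the vertex set $[n]=\{1,\dots,n\}$, in which each of the $\binom n2$ possible edges is present independently with probability $p$. For distinct vertices $i,j\in[n]$, let $S_{ij}^{(n)}$ be the number of common neighbors of $i$ and $j$, and let $T_{ij}^{(n)}$ be the number of vertices $k\in[n]\setminus\{i,j\}$ that are adjacent to at least one of $i$ and $j$. The Jaccard index of $i$ and $j$ is $$J_{ij}^{(n)}=\frac{S_{ij}^{(n)}}{T_{ij}^{(n)}}\ \text{ if } T_{ij}^{(n)}>0,\qquad J_{ij}^{(n)}=\frac{p}{2-p}\ \text{ if } T_{ij}^{(n)}=0.$$ Then, for any choice of distinct vertices $i,j\in[n]$ (possibly depending on $n$), the following hold as $n\to\infty$. 1. If $np^2(1-p)\to\infty$, then $$\sqrt{\frac{n(2-p)^3}{2(1-p)}}\left(J_{ij}^{(n)}-\frac{p}{2-p}\right)\to Z$$ in distribution, where $Z$ is a standard normal random variable. 2. If $np^2\to\lambda$ for some constant $\lambda>0$, then $2np\,J_{ij}^{(n)}\to\mathrm{Poi}(\lambda)$ in distribution, where $\mathrm{Poi}(\lambda)$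 denotes the Poisson distribution with parameter $\lambda$. 3. If $np^2\to0$, then $np\,J_{ij}^{(n)}\to0$ in probability. 4. If $n(1-p)\to c$ for some constant $c>0$, then $n\bigl(1-J_{ij}^{(n)}\bigr)\to\mathrm{Poi}(2c)$ in distribution. 5. If $n(1-p)\to0$, then $n\bigl(1-J_{ij}^{(n)}\bigr)\to0$ in probability. -/

import Mathlib

open MeasureTheory ProbabilityTheory Filter Topology
open scoped NNReal

/-- The union neighborhood of two vertices `i`, `j`: all vertices other than `i` and `j` that are
adjacent to at least one of them. -/
def SimpleGraph.unionNeighbors {V : Type*} (G : SimpleGraph V) (i j : V) : Set V :=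
  {k | (G.Adj i k ∨ G.Adj j k) ∧ k ≠ i ∧ k ≠ j}

/-- The Jaccard index of the vertices `i` and `j` of `G` (viewed as a realization of the
random graph with edge probability `p`): the number of common neighbors divided by the size of the
union neighborhood, with the value `p / (2 - p)` if the union neighborhood is empty. -/
noncomputable def jaccardIndex {V : Type*} (p : ℝ) (i j : V) (G : SimpleGraph V) : ℝ :=
  open Classical in
  if (G.unionNeighbors i j).ncard = 0 then p / (2 - p)
  else ((G.commonNeighbors i j).ncard : ℝ) / ((G.unionNeighbors i j).ncard : ℝ)

/-- Convergence in probability to a real constant `a`, for random variables `X n` that may live on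
different probability spaces `(Ω n, μ n)`. -/
def TendstoInProbability {Ω : ℕ → Type*} [∀ n, MeasurableSpace (Ω n)]
    (X : (n : ℕ) → Ω n → ℝ) (μ : (n : ℕ) → Measure (Ω n)) (a : ℝ) : Prop :=
  (∀ n, AEMeasurable (X n) (μ n)) ∧
    ∀ ε : ℝ, 0 < ε → Tendsto (fun n => (μ n).real {ω | ε ≤ |X n ω - a|}) atTop (𝓝 0)

/-! Write S and T for the sizes of the common and the union neighborhood. The other vertices
contribute independent, identically distributed pairs of edge indicators, so linear combinations of
S and T are i.i.d. sums with explicit characteristic functions (`charFun_pairSum`). If np → ∞,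
Chebyshev gives U = T/(np(2-p)) → 1 in probability (`tendsto_measureReal_eitherInd`). Since JT = S,
the rescaled index Y satisfies YU = aX with a → 1 deterministic and X an i.i.d. sum: the normalized
(2-p)S - pT in the Gaussian regime, S in the sparse one, T - S in the dense one. A Slutsky argument
(`tendstoInDistribution_of_mul_eq`) passes the limit of X to Y. The limit of X is a triangular-array
CLT (`tendsto_integral_exp_pow`) or the Poisson limit of Bernoulli sums
(`tendsto_charFun_pairSum_poisson`). In the degenerate regimes S = 0, respectively S = T, with
probability tending to one by Markov, and the default value at T = 0 is small enough to be harmless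
(`tendstoInProbability_zero_of_pairSum`). -/

/-! ### Independence of the adjacency pairs. -/

instance SimpleGraph.instMeasurableSingletonClass {V : Type*} [Countable V] :
    MeasurableSingletonClass (SimpleGraph V) where
  measurableSet_singleton G := by
    refine ⟨{G.Adj}, measurableSet_singleton _, ?_⟩
    ext H
    exact SimpleGraph.adj_inj

/-- The Bernoulli distribution on `Prop`. -/
noncomputable def bernoulliProp (p : unitInterval) : Measure Prop :=
  unitInterval.toNNReal p • Measure.dirac True
    + unitInterval.toNNReal (unitInterval.symm p) • Measure.dirac False

instance (p : unitInterval) : IsProbabilityMeasure (bernoulliProp p) := by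
  constructor
  simp [bernoulliProp]

/-- The distribution of two independent Bernoulli variables, indexed by `Bool`. -/
noncomputable def bernoulliPair (p : unitInterval) : Measure (Bool → Prop) :=
  Measure.infinitePi fun _ => bernoulliProp p

instance (p : unitInterval) : IsProbabilityMeasure (bernoulliPair p) := by
  unfold bernoulliPair; infer_instance

lemma integral_bernoulliProp {E : Type*} [NormedAddCommGroup E] [NormedSpace ℝ E] [CompleteSpace E]
    (p : unitInterval) (f : Prop → E) :
    ∫ x, f x ∂bernoulliProp p = (p : ℝ) • f True + (1 - p : ℝ) • f False := by
  unfold bernoulliProp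
  rw [integral_add_measure Integrable.of_finite Integrable.of_finite]
  simp [integral_smul_nnreal_measure, NNReal.smul_def]

lemma integral_bernoulliPair {E : Type*} [NormedAddCommGroup E] [NormedSpace ℝ E] [CompleteSpace E]
    (p : unitInterval) (f : Prop → Prop → E) :
    ∫ x, f (x true) (x false) ∂bernoulliPair p =
      (p : ℝ) ^ 2 • f True True + ((p : ℝ) * (1 - p)) • (f True False + f False True)
        + (1 - p : ℝ) ^ 2 • f False False := by
  have h : (bernoulliPair p).map (fun x => (x true, x false)) =
      (bernoulliProp p).prod (bernoulliProp p) :=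
    Measure.infinitePi_map_eval_prod (by simp)
  have h2 : ∫ x, f (x true) (x false) ∂bernoulliPair p =
      ∫ y : Prop × Prop, f y.1 y.2 ∂((bernoulliPair p).map (fun x => (x true, x false))) := by
    rw [integral_map (Measurable.of_discrete).aemeasurable
      Integrable.of_finite.aestronglyMeasurable]
  rw [h2, h, integral_prod _ Integrable.of_finite]
  simp only [integral_bernoulliProp]
  module

/-- The adjacencies of `i` and of `j` to the vertices other than `i` and `j`. -/
def pairAdj {V : Type*} (i j : V) (k : {k : V // k ≠ i ∧ k ≠ j}) (G : SimpleGraph V) (b : Bool) :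
    Prop :=
  G.Adj (if b then i else j) k

/-- Distinct (k, b) give distinct non-loop edges, so these adjacencies are distinct coordinates of
the product measure defining the random graph. Reindexing along an injection preserves product
measures, and currying groups the coordinates by k. -/
lemma map_pairAdj_binomialRandom {V : Type*} [Countable V] (p : unitInterval) {i j : V}
    (hij : i ≠ j) :
    (SimpleGraph.binomialRandom V p).map (fun G k => pairAdj i j k G) =
      Measure.infinitePi fun _ => bernoulliPair p := by
  classical
  set e : {k : V // k ≠ i ∧ k ≠ j} × Bool → Sym2 V := fun q => s(if q.2 then i else j, q.1) with he
  have hinj : Function.Injective e := by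
    rintro ⟨⟨k, hk⟩, b⟩ ⟨⟨l, hl⟩, c⟩ h
    simp only [he, Sym2.eq_iff] at h
    cases b <;> cases c <;> simp_all
  have hdiag : ∀ q, ¬ (e q).IsDiag := by
    rintro ⟨⟨k, hk⟩, b⟩
    cases b <;> simp [he, hk.1.symm, hk.2.symm]
  -- The law of one coordinate: Bernoulli off the diagonal, the point mass at `False` on it.
  set Q : Sym2 V → Measure Prop := fun a => unitInterval.toNNReal p •
    Measure.dirac (a ∈ (Sym2.diagSetᶜ : Set (Sym2 V)))
    + unitInterval.toNNReal (unitInterval.symm p) • Measure.dirac False with hQ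
  have : ∀ a, IsProbabilityMeasure (Q a) := fun a => by
    constructor
    simp [hQ]
  have hQe : ∀ q, Q (e q) = bernoulliProp p := by
    intro q
    simp only [hQ, bernoulliProp]
    have : (e q ∈ (Sym2.diagSetᶜ : Set (Sym2 V))) = True := by simp [hdiag q]
    rw [this]
  rw [SimpleGraph.binomialRandom_eq_map, setBernoulli_eq_map]
  have hm : Measurable (fun (G : SimpleGraph V) k => pairAdj i j k G) := by
    refine measurable_pi_lambda _ fun k => measurable_pi_lambda _ fun b => ?_
    have := SimpleGraph.measurable_adj (V := V)
    exact (measurable_pi_apply _).comp ((measurable_pi_apply _).comp this)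
  have hset : Measurable (fun x : Sym2 V → Prop => {a | x a}) :=
    MeasurableEquiv.setOfPred.measurable
  rw [Measure.map_map SimpleGraph.measurable_fromEdgeSet hset,
    Measure.map_map hm (SimpleGraph.measurable_fromEdgeSet.comp hset)]
  have hfun : ((fun (G : SimpleGraph V) k => pairAdj i j k G) ∘
      (SimpleGraph.fromEdgeSet ∘ fun x : Sym2 V → Prop => {a | x a})) =
      (MeasurableEquiv.curry _ _ _) ∘ (fun x q => x (e q)) := by
    funext x k b
    have := hdiag (k, b)
    simp only [he, Sym2.mk_isDiag_iff] at this
    simp [pairAdj, he, this, MeasurableEquiv.curry, Function.curry]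
  rw [hfun, ← Measure.map_map (MeasurableEquiv.measurable _) (by fun_prop)]
  change Measure.map _ (Measure.map _ (Measure.infinitePi Q)) = _
  rw [Measure.map_infinitePi_infinitePi_of_inj hinj]
  simp_rw [hQe]
  exact Measure.infinitePi_map_curry (fun _ _ => bernoulliProp p)

section Finite

variable {V : Type*} [Finite V]

lemma iIndepFun_pairAdj (p : unitInterval) {i j : V} (hij : i ≠ j) :
    iIndepFun (pairAdj i j) (SimpleGraph.binomialRandom V p) := by
  have hm : ∀ k, Measurable (pairAdj i j k) := fun k => Measurable.of_discrete
  rw [iIndepFun_iff_map_fun_eq_infinitePi_map hm, map_pairAdj_binomialRandom p hij]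
  congr 1
  funext k
  have : (SimpleGraph.binomialRandom V p).map (pairAdj i j k) =
      ((SimpleGraph.binomialRandom V p).map (fun G k => pairAdj i j k G)).map (fun x => x k) := by
    rw [Measure.map_map (measurable_pi_apply k) Measurable.of_discrete]
    rfl
  rw [this, map_pairAdj_binomialRandom p hij, Measure.infinitePi_map_eval]

lemma map_pairAdj (p : unitInterval) {i j : V} (hij : i ≠ j) (k) :
    (SimpleGraph.binomialRandom V p).map (pairAdj i j k) = bernoulliPair p := by
  have : (SimpleGraph.binomialRandom V p).map (pairAdj i j k) =
      ((SimpleGraph.binomialRandom V p).map (fun G k => pairAdj i j k G)).map (fun x => x k) := by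
    rw [Measure.map_map (measurable_pi_apply k) Measurable.of_discrete]
    rfl
  rw [this, map_pairAdj_binomialRandom p hij, Measure.infinitePi_map_eval]

end Finite

/-! ### Sums over the remaining vertices, and the Jaccard index in terms of them. -/

section PairSum

variable {V : Type*} [Fintype V] [DecidableEq V]

/-- The sum of `f` over the adjacency pairs of all vertices other than `i` and `j`. -/
noncomputable def pairSum (i j : V) (f : (Bool → Prop) → ℝ) (G : SimpleGraph V) : ℝ :=
  ∑ k, f (pairAdj i j k G)

lemma card_ne_ne {i j : V} (hij : i ≠ j) :
    Fintype.card {k : V // k ≠ i ∧ k ≠ j} = Fintype.card V - 2 := by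
  have : (Finset.univ.filter fun k : V => k ≠ i ∧ k ≠ j) = ({i, j} : Finset V)ᶜ := by
    ext; simp
  rw [Fintype.card_subtype, this, Finset.card_compl, Finset.card_pair hij]

lemma integral_comp_pairAdj {E : Type*} [NormedAddCommGroup E] [NormedSpace ℝ E]
    (p : unitInterval) {i j : V} (hij : i ≠ j) (k) (f : (Bool → Prop) → E) :
    ∫ G, f (pairAdj i j k G) ∂SimpleGraph.binomialRandom V p = ∫ x, f x ∂bernoulliPair p := by
  rw [← map_pairAdj p hij k, integral_map Measurable.of_discrete.aemeasurable
    Integrable.of_finite.aestronglyMeasurable]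

lemma charFun_pairSum (p : unitInterval) {i j : V} (hij : i ≠ j) (f : (Bool → Prop) → ℝ) (t : ℝ) :
    charFun ((SimpleGraph.binomialRandom V p).map (pairSum i j f)) t =
      (∫ x, Complex.exp (t * f x * Complex.I) ∂bernoulliPair p) ^ (Fintype.card V - 2) := by
  have h := ((iIndepFun_pairAdj p hij).comp (fun _ => f)
    (fun _ => Measurable.of_discrete)).charFun_map_fun_sum_eq_prod
      (fun _ => Measurable.of_discrete.aemeasurable)
  have h' := congrFun h t
  simp only [Function.comp_def] at h'
  unfold pairSum
  rw [h', Finset.prod_apply, ← card_ne_ne hij, ← Finset.card_univ, ← Finset.prod_const]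
  refine Finset.prod_congr rfl fun k _ => ?_
  rw [charFun_apply_real, integral_map Measurable.of_discrete.aemeasurable
    (by fun_prop)]
  exact integral_comp_pairAdj p hij k (fun x => Complex.exp (t * f x * Complex.I))

lemma integral_pairSum (p : unitInterval) {i j : V} (hij : i ≠ j) (f : (Bool → Prop) → ℝ) :
    ∫ G, pairSum i j f G ∂SimpleGraph.binomialRandom V p =
      (Fintype.card V - 2 : ℕ) * ∫ x, f x ∂bernoulliPair p := by
  unfold pairSum
  rw [integral_finsetSum _ fun _ _ => Integrable.of_finite]
  simp_rw [integral_comp_pairAdj p hij]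
  simp [card_ne_ne hij]

lemma memLp_of_finite {α E : Type*} [Finite α] [MeasurableSpace α] [MeasurableSingletonClass α]
    [NormedAddCommGroup E] (μ : Measure α) [IsFiniteMeasure μ] (f : α → E) (q : ENNReal) :
    MemLp f q μ := by
  obtain ⟨C, hC⟩ := (Set.finite_range fun x => ‖f x‖).bddAbove
  exact MemLp.of_bound Integrable.of_finite.aestronglyMeasurable C
    (ae_of_all _ fun x => hC ⟨x, rfl⟩)

lemma variance_pairSum (p : unitInterval) {i j : V} (hij : i ≠ j) (f : (Bool → Prop) → ℝ) :
    Var[pairSum i j f; SimpleGraph.binomialRandom V p] =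
      (Fintype.card V - 2 : ℕ) * Var[f; bernoulliPair p] := by
  have hind := (iIndepFun_pairAdj p hij).comp (fun _ => f) (fun _ => Measurable.of_discrete)
  have h := IndepFun.variance_sum (μ := SimpleGraph.binomialRandom V p) (s := Finset.univ)
    (X := fun (k : {k : V // k ≠ i ∧ k ≠ j}) => f ∘ pairAdj i j k)
    (fun _ _ => memLp_of_finite _ _ _) (fun a _ b _ hab => hind.indepFun hab)
  have h2 : ∑ k, f ∘ pairAdj i j k = pairSum i j f := by
    ext G
    simp [pairSum]
  rw [h2] at h
  rw [h]
  have h3 : ∀ k, Var[f ∘ pairAdj i j k; SimpleGraph.binomialRandom V p] =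
      Var[f; bernoulliPair p] := fun k => by
    rw [← map_pairAdj p hij k, variance_map Measurable.of_discrete.aemeasurable
      Measurable.of_discrete.aemeasurable]
  simp [h3, card_ne_ne hij]

open Classical in
/-- The indicator that both adjacencies hold. -/
noncomputable def bothInd (x : Bool → Prop) : ℝ := if x true ∧ x false then 1 else 0

open Classical in
/-- The indicator that at least one of the adjacencies holds. -/
noncomputable def eitherInd (x : Bool → Prop) : ℝ := if x true ∨ x false then 1 else 0

lemma pairSum_bothInd {i j : V} (G : SimpleGraph V) :
    pairSum i j bothInd G = ((G.commonNeighbors i j).ncard : ℝ) := by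
  classical
  have h : (G.commonNeighbors i j) = Subtype.val ''
      ((Finset.univ.filter fun k : {k : V // k ≠ i ∧ k ≠ j} =>
        G.Adj i k ∧ G.Adj j k : Finset {k : V // k ≠ i ∧ k ≠ j}) :
          Set {k : V // k ≠ i ∧ k ≠ j}) := by
    ext k
    simp only [SimpleGraph.mem_commonNeighbors, Set.mem_image, Finset.coe_filter, Finset.mem_univ,
      true_and, Set.mem_ofPred_eq, Subtype.exists, exists_and_right, exists_eq_right,
      exists_prop]
    exact ⟨fun hk => ⟨⟨⟨hk.1.ne', hk.2.ne'⟩, hk.1⟩, hk.2⟩, fun ⟨⟨_, h1⟩, h2⟩ => ⟨h1, h2⟩⟩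
  rw [h, Set.ncard_image_of_injective _ Subtype.val_injective, Set.ncard_coe_finset]
  simp [pairSum, bothInd, pairAdj]

lemma pairSum_eitherInd {i j : V} (G : SimpleGraph V) :
    pairSum i j eitherInd G = ((G.unionNeighbors i j).ncard : ℝ) := by
  classical
  have h : (G.unionNeighbors i j) = Subtype.val ''
      ((Finset.univ.filter fun k : {k : V // k ≠ i ∧ k ≠ j} =>
        G.Adj i k ∨ G.Adj j k : Finset {k : V // k ≠ i ∧ k ≠ j}) :
          Set {k : V // k ≠ i ∧ k ≠ j}) := by
    ext k
    simp only [SimpleGraph.unionNeighbors, Set.mem_image, Finset.coe_filter, Finset.mem_univ,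
      true_and, Set.mem_ofPred_eq, Subtype.exists, exists_and_right, exists_eq_right,
      exists_prop]
    exact ⟨fun hk => ⟨hk.2, hk.1⟩, fun ⟨h, hk⟩ => ⟨hk, h⟩⟩
  rw [h, Set.ncard_image_of_injective _ Subtype.val_injective, Set.ncard_coe_finset]
  simp [pairSum, eitherInd, pairAdj]

lemma pairSum_sub {i j : V} (f g : (Bool → Prop) → ℝ) (G : SimpleGraph V) :
    pairSum i j (fun x => f x - g x) G = pairSum i j f G - pairSum i j g G := by
  simp [pairSum]

lemma pairSum_const_mul {i j : V} (c : ℝ) (f : (Bool → Prop) → ℝ) (G : SimpleGraph V) :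
    pairSum i j (fun x => c * f x) G = c * pairSum i j f G := by
  simp [pairSum, Finset.mul_sum]

lemma jaccardIndex_mul_pairSum (p : ℝ) {i j : V} (G : SimpleGraph V)
    (h : pairSum i j eitherInd G ≠ 0) :
    jaccardIndex p i j G * pairSum i j eitherInd G = pairSum i j bothInd G := by
  rw [pairSum_eitherInd] at *
  rw [pairSum_bothInd, jaccardIndex, if_neg (by exact_mod_cast h), div_mul_cancel₀ _ h]

lemma jaccardIndex_of_pairSum_eq_zero (p : ℝ) {i j : V} (G : SimpleGraph V)
    (h : pairSum i j eitherInd G = 0) : jaccardIndex p i j G = p / (2 - p) := by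
  rw [pairSum_eitherInd] at h
  rw [jaccardIndex, if_pos (by exact_mod_cast h)]

end PairSum

section Pair

variable {E : Type*} [NormedAddCommGroup E] [NormedSpace ℝ E] [CompleteSpace E] (p : unitInterval)

/-- The two indicators jointly take only the values (1,1), (0,1), (0,0). All later moments and
characteristic functions are instances of this formula. -/
lemma integral_bothInd_eitherInd (F : ℝ → ℝ → E) :
    ∫ x, F (bothInd x) (eitherInd x) ∂bernoulliPair p =
      (p : ℝ) ^ 2 • F 1 1 + (2 * (p : ℝ) * (1 - p)) • F 0 1 + (1 - p : ℝ) ^ 2 • F 0 0 := by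
  classical
  refine (integral_bernoulliPair p fun a b =>
    F (if a ∧ b then 1 else 0) (if a ∨ b then 1 else 0)).trans ?_
  simp
  module

end Pair

/-! ### Slutsky arguments through characteristic functions. -/

section Convergence

variable {Ω : ℕ → Type*} [∀ n, MeasurableSpace (Ω n)] {μ : (n : ℕ) → Measure (Ω n)}
  [∀ n, IsProbabilityMeasure (μ n)]

lemma tendstoInDistribution_of_tendsto_charFun {Ω' : Type*} [MeasurableSpace Ω']
    {ν : Measure Ω'} [IsProbabilityMeasure ν] {X : (n : ℕ) → Ω n → ℝ} {Z : Ω' → ℝ}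
    (hX : ∀ n, AEMeasurable (X n) (μ n)) (hZ : AEMeasurable Z ν)
    (h : ∀ t : ℝ, Tendsto (fun n => charFun ((μ n).map (X n)) t) atTop
      (𝓝 (charFun (ν.map Z) t))) :
    TendstoInDistribution X atTop Z μ ν where
  forall_aemeasurable := hX
  aemeasurable_limit := hZ
  tendsto := ProbabilityMeasure.tendsto_of_tendsto_charFun h

/-- Where X and Y are ε-close, use that x ↦ exp(itx) is |t|-Lipschitz; elsewhere the two
exponentials differ by at most 2. -/
lemma norm_charFun_map_sub_le {α : Type*} [MeasurableSpace α] {P : Measure α}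
    [IsProbabilityMeasure P] {X Y : α → ℝ} (hX : AEMeasurable X P) (hY : AEMeasurable Y P)
    (t : ℝ) {ε : ℝ} (hε : 0 ≤ ε) :
    ‖charFun (P.map Y) t - charFun (P.map X) t‖ ≤
      |t| * ε + 2 * P.real {ω | ε ≤ |Y ω - X ω|} := by
  have hint : ∀ {Z : α → ℝ}, AEMeasurable Z P →
      Integrable (fun ω => Complex.exp (t * Z ω * Complex.I)) P := fun {Z} hZ => by
    refine Integrable.of_bound (by fun_prop) 1 (ae_of_all _ fun ω => ?_)
    rw [← Complex.ofReal_mul, Complex.norm_exp_ofReal_mul_I]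
  rw [charFun_apply_real, charFun_apply_real, integral_map hX (by fun_prop),
    integral_map hY (by fun_prop), ← integral_sub (hint hY) (hint hX)]
  set A : Set α := {ω | ε ≤ |Y ω - X ω|} with hA
  have hAm : NullMeasurableSet A P :=
    nullMeasurableSet_le (by fun_prop) (by fun_prop)
  have hindint : Integrable (A.indicator fun _ => (2 : ℝ)) P :=
    (integrable_const (2 : ℝ)).indicator₀ hAm
  calc _ ≤ ∫ ω, (|t| * ε + A.indicator (fun _ => (2 : ℝ)) ω) ∂P := by
        refine norm_integral_le_of_norm_le ((integrable_const _).add hindint)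
          (ae_of_all _ fun ω => ?_)
        by_cases hω : ω ∈ A
        · rw [Set.indicator_of_mem hω]
          refine (norm_sub_le _ _).trans ?_
          rw [← Complex.ofReal_mul, ← Complex.ofReal_mul, Complex.norm_exp_ofReal_mul_I,
            Complex.norm_exp_ofReal_mul_I]
          have : 0 ≤ |t| * ε := by positivity
          linarith
        · rw [Set.indicator_of_notMem hω, add_zero]
          have hlt : |Y ω - X ω| ≤ ε := (not_le.mp hω).le
          have h1 : Complex.exp (t * Y ω * Complex.I) - Complex.exp (t * X ω * Complex.I) =
              Complex.exp (t * X ω * Complex.I) *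
                (Complex.exp (Complex.I * ((t * (Y ω - X ω) : ℝ) : ℂ)) - 1) := by
            rw [mul_sub, ← Complex.exp_add, mul_one]
            congr 2
            push_cast
            ring
          rw [h1, norm_mul, ← Complex.ofReal_mul, Complex.norm_exp_ofReal_mul_I, one_mul]
          refine (Real.norm_exp_I_mul_ofReal_sub_one_le).trans ?_
          rw [Real.norm_eq_abs, abs_mul]
          gcongr
    _ = |t| * ε + 2 * P.real A := by
        rw [integral_add (integrable_const _) hindint, integral_indicator₀ hAm]
        simp [mul_comm]

lemma tendsto_charFun_map_of_tendstoInProbability_sub {X Y : (n : ℕ) → Ω n → ℝ}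
    (hX : ∀ n, AEMeasurable (X n) (μ n)) (hY : ∀ n, AEMeasurable (Y n) (μ n))
    (h : ∀ ε : ℝ, 0 < ε → Tendsto (fun n => (μ n).real {ω | ε ≤ |Y n ω - X n ω|}) atTop (𝓝 0))
    {t : ℝ} {φ : ℂ} (hφ : Tendsto (fun n => charFun ((μ n).map (X n)) t) atTop (𝓝 φ)) :
    Tendsto (fun n => charFun ((μ n).map (Y n)) t) atTop (𝓝 φ) := by
  have h0 : Tendsto (fun n => charFun ((μ n).map (Y n)) t - charFun ((μ n).map (X n)) t)
      atTop (𝓝 0) := by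
    rw [tendsto_zero_iff_norm_tendsto_zero, Metric.tendsto_nhds]
    intro δ hδ
    set ε : ℝ := δ / (2 * (|t| + 1)) with hε
    have hεpos : 0 < ε := by positivity
    have hle : |t| * ε ≤ δ / 2 := by
      rw [hε, mul_div_assoc', div_le_div_iff₀ (by positivity) (by norm_num)]
      nlinarith [abs_nonneg t]
    filter_upwards [(h ε hεpos).eventually_lt_const (show (0 : ℝ) < δ / 4 by positivity)] with n hn
    rw [Real.dist_eq, sub_zero, abs_norm]
    have := norm_charFun_map_sub_le (hX n) (hY n) t hεpos.le
    linarith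
  simpa using h0.add hφ

/-- From (Y - X)U = ((a - 1) - (U - 1))X, the difference Y - X is a small multiple of X wherever U
is near 1, and X is tight by its L¹ bound. Values of Y where U = 0 do not matter. -/
lemma tendsto_measureReal_sub_of_mul_eq {X Y U : (n : ℕ) → Ω n → ℝ} {a : ℕ → ℝ} {C : ℝ}
    (hX : ∀ᶠ n in atTop, Integrable (X n) (μ n) ∧ ∫ ω, |X n ω| ∂μ n ≤ C)
    (hU : ∀ ε : ℝ, 0 < ε → Tendsto (fun n => (μ n).real {ω | ε ≤ |U n ω - 1|}) atTop (𝓝 0))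
    (ha : Tendsto a atTop (𝓝 1))
    (hYU : ∀ᶠ n in atTop, ∀ ω, U n ω ≠ 0 → Y n ω * U n ω = a n * X n ω)
    {ε : ℝ} (hε : 0 < ε) :
    Tendsto (fun n => (μ n).real {ω | ε ≤ |Y n ω - X n ω|}) atTop (𝓝 0) := by
  have hC : 0 ≤ C := by
    obtain ⟨n, _, hn⟩ := hX.exists
    exact (integral_nonneg fun _ => abs_nonneg _).trans hn
  rw [Metric.tendsto_nhds]
  intro η hη
  -- With δ ≤ 1/2, U > 1/2 on the good event, so |Y - X| ≤ 4δ|X|; Markov bounds the probability of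
  -- |X| ≥ ε/(4δ) by 4δC/ε.
  obtain ⟨δ, hδ, hδ2, hδC⟩ : ∃ δ : ℝ, 0 < δ ∧ δ ≤ 1 / 2 ∧ 4 * δ * C / ε ≤ η / 2 := by
    refine ⟨min (1 / 2) (η * ε / (8 * (C + 1))), by positivity, min_le_left _ _, ?_⟩
    have h1 : min (1 / 2) (η * ε / (8 * (C + 1))) ≤ η * ε / (8 * (C + 1)) := min_le_right _ _
    rw [div_le_iff₀ hε]
    have h2 : η * ε / (8 * (C + 1)) * (8 * (C + 1)) = η * ε := div_mul_cancel₀ _ (by positivity)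
    have h3 : 0 < min (1 / 2) (η * ε / (8 * (C + 1))) := by positivity
    nlinarith
  filter_upwards [hX, hYU, (hU δ hδ).eventually_lt_const (show (0 : ℝ) < η / 2 by positivity),
    Metric.tendsto_nhds.mp ha δ hδ] with n hXn hYUn hUn han
  rw [Real.dist_eq, sub_zero, abs_of_nonneg measureReal_nonneg]
  have hsub : {ω | ε ≤ |Y n ω - X n ω|} ⊆ {ω | δ ≤ |U n ω - 1|} ∪ {ω | ε / (4 * δ) ≤ |X n ω|} := by
    intro ω hω
    by_contra hcon
    simp only [Set.mem_union, Set.mem_ofPred_eq, not_or, not_le] at hcon hω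
    obtain ⟨h1, h2⟩ := hcon
    have hUpos : 1 / 2 < U n ω := by linarith [(abs_lt.mp h1).1]
    have h3 := hYUn ω (by positivity)
    have h4 : (Y n ω - X n ω) * U n ω = ((a n - 1) - (U n ω - 1)) * X n ω := by linear_combination h3
    have h5 : |Y n ω - X n ω| * U n ω ≤ 2 * δ * |X n ω| := by
      rw [← abs_of_pos (show 0 < U n ω by linarith), ← abs_mul, h4, abs_mul]
      gcongr
      rw [Real.dist_eq] at han
      linarith [abs_sub (a n - 1) (U n ω - 1)]
    rw [lt_div_iff₀ (by positivity)] at h2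
    nlinarith [abs_nonneg (Y n ω - X n ω)]
  have hmark : (μ n).real {ω | ε / (4 * δ) ≤ |X n ω|} ≤ 4 * δ * C / ε := by
    have := mul_meas_ge_le_integral_of_nonneg (μ := μ n) (f := fun ω => |X n ω|)
      (ae_of_all _ fun _ => abs_nonneg _) hXn.1.abs (ε / (4 * δ))
    have h2 := this.trans hXn.2
    rw [le_div_iff₀ hε]
    rw [div_mul_eq_mul_div, div_le_iff₀ (by positivity)] at h2
    linarith
  calc _ ≤ _ := measureReal_mono hsub
    _ ≤ _ := measureReal_union_le _ _
    _ < η := by linarith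

end Convergence

/-! ### A central limit theorem for bounded triangular arrays. -/

lemma norm_exp_mul_I_sub_taylor_le {x : ℝ} (hx : |x| ≤ 1) :
    ‖Complex.exp (x * Complex.I) - 1 - x * Complex.I + (x : ℂ) ^ 2 / 2‖ ≤ |x| ^ 3 := by
  have h := Complex.exp_bound (x := x * Complex.I) (by simpa using hx) (n := 3) (by norm_num)
  have h1 : ∑ m ∈ Finset.range 3, ((x : ℂ) * Complex.I) ^ m / (m.factorial : ℂ) =
      1 + x * Complex.I - (x : ℂ) ^ 2 / 2 := by
    simp only [Finset.sum_range_succ, Finset.sum_range_zero, mul_pow, Complex.I_sq,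
      Nat.factorial]
    push_cast
    ring
  rw [h1] at h
  have h2 : Complex.exp (x * Complex.I) - 1 - x * Complex.I + (x : ℂ) ^ 2 / 2 =
      Complex.exp (x * Complex.I) - (1 + x * Complex.I - (x : ℂ) ^ 2 / 2) := by ring
  rw [h2]
  refine h.trans ?_
  simp only [norm_mul, Complex.norm_real, Real.norm_eq_abs, Complex.norm_I, mul_one]
  have : 0 ≤ |x| ^ 3 := by positivity
  norm_num [Nat.factorial]
  linarith

/-- The characteristic function form of the central limit theorem for triangular arrays of bounded
centred variables. -/
lemma tendsto_integral_exp_pow {α : Type*} [MeasurableSpace α] [Finite α]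
    [MeasurableSingletonClass α] {ρ : ℕ → Measure α} [∀ n, IsProbabilityMeasure (ρ n)]
    {f : ℕ → α → ℝ} {v : ℕ → ℝ} {C : ℝ} (hC : ∀ n x, |f n x| ≤ C)
    (hmean : ∀ n, ∫ x, f n x ∂ρ n = 0) (hvar : ∀ n, ∫ x, f n x ^ 2 ∂ρ n = v n)
    (hv : Tendsto (fun n : ℕ => n * v n) atTop atTop) (t : ℝ) :
    Tendsto (fun n : ℕ => (∫ x, Complex.exp (t * ((√(n * v n))⁻¹ * f n x : ℝ) * Complex.I) ∂ρ n) ^ n)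
      atTop (𝓝 (Complex.exp (-t ^ 2 / 2))) := by
  have hs : Tendsto (fun n : ℕ => t * (√(n * v n))⁻¹) atTop (𝓝 0) := by
    simpa using (tendsto_inv_atTop_zero.comp (Real.tendsto_sqrt_atTop.comp hv)).const_mul t
  -- It suffices that n(φ - 1) → -t²/2 for the one-summand characteristic function φ. With s =
  -- t/√(nv), so that nvs² = t², the cubic Taylor remainder contributes at most n|s|³Cv = |s|t²C →
  -- 0.
  have key : Tendsto (fun n : ℕ =>
      n * (∫ x, Complex.exp (t * ((√(n * v n))⁻¹ * f n x : ℝ) * Complex.I) ∂ρ n - 1)) atTop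
      (𝓝 (-t ^ 2 / 2)) := by
    rw [tendsto_iff_norm_sub_tendsto_zero]
    have hlim : Tendsto (fun n : ℕ => |t * (√(n * v n))⁻¹| * (t ^ 2 * C)) atTop (𝓝 0) := by
      simpa using hs.abs.mul_const (t ^ 2 * C)
    have hsC : ∀ᶠ n : ℕ in atTop, |t * (√(n * v n))⁻¹| * C ≤ 1 := by
      have := (hs.abs.mul_const C)
      rw [abs_zero, zero_mul] at this
      exact (this.eventually_lt_const one_pos).mono fun _ h => h.le
    refine squeeze_zero' (Eventually.of_forall fun _ => norm_nonneg _) ?_ hlim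
    filter_upwards [hv.eventually_gt_atTop 0, hsC] with n hn hsn
    set s : ℝ := t * (√(n * v n))⁻¹ with hsdef
    have hs2 : n * v n * s ^ 2 = t ^ 2 := by
      rw [hsdef, mul_pow, inv_pow, Real.sq_sqrt hn.le]
      rw [mul_comm, mul_assoc, inv_mul_cancel₀ hn.ne', mul_one]
    have hi : ∀ g : α → ℂ, Integrable g (ρ n) := fun g => Integrable.of_finite
    have hx : ∀ x, |s * f n x| ≤ 1 := fun x => by
      rw [abs_mul]
      exact (mul_le_mul_of_nonneg_left (hC n x) (abs_nonneg s)).trans hsn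
    have e1 : ∫ x, ((f n x : ℝ) : ℂ) ∂ρ n = 0 := by
      rw [integral_complex_ofReal, hmean, Complex.ofReal_zero]
    have e2 : ∫ x, ((f n x ^ 2 : ℝ) : ℂ) ∂ρ n = v n := by
      rw [integral_complex_ofReal, hvar]
    have e3 : ∫ x, (Complex.exp (((s * f n x : ℝ) : ℂ) * Complex.I) - 1
        - ((s * f n x : ℝ) : ℂ) * Complex.I + ((s * f n x : ℝ) : ℂ) ^ 2 / 2) ∂ρ n =
        ∫ x, Complex.exp (t * ((√(n * v n))⁻¹ * f n x : ℝ) * Complex.I) ∂ρ n - 1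
          + (s : ℂ) ^ 2 * v n / 2 := by
      rw [integral_add (hi _) (hi _), integral_sub (hi _) (hi _), integral_sub (hi _) (hi _)]
      have a1 : ∫ x, ((s * f n x : ℝ) : ℂ) * Complex.I ∂ρ n = 0 := by
        have : ∀ x, ((s * f n x : ℝ) : ℂ) * Complex.I = (s * Complex.I) * ((f n x : ℝ) : ℂ) :=
          fun x => by push_cast; ring
        simp_rw [this]
        rw [integral_const_mul, e1, mul_zero]
      have a2 : ∫ x, ((s * f n x : ℝ) : ℂ) ^ 2 / 2 ∂ρ n = (s : ℂ) ^ 2 * v n / 2 := by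
        have : ∀ x, ((s * f n x : ℝ) : ℂ) ^ 2 / 2 = ((s : ℂ) ^ 2 / 2) * ((f n x ^ 2 : ℝ) : ℂ) :=
          fun x => by push_cast; ring
        simp_rw [this]
        rw [integral_const_mul, e2]
        ring
      rw [a1, a2]
      have a3 : ∀ x, ((s * f n x : ℝ) : ℂ) = t * ((√(n * v n))⁻¹ * f n x : ℝ) := fun x => by
        rw [hsdef]; push_cast; ring
      simp_rw [a3]
      simp
    have e4 : (n : ℂ) * (∫ x, Complex.exp (t * ((√(n * v n))⁻¹ * f n x : ℝ) * Complex.I) ∂ρ n - 1)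
        - (-t ^ 2 / 2) = n * ∫ x, (Complex.exp (((s * f n x : ℝ) : ℂ) * Complex.I) - 1
        - ((s * f n x : ℝ) : ℂ) * Complex.I + ((s * f n x : ℝ) : ℂ) ^ 2 / 2) ∂ρ n := by
      rw [e3]
      have : (n : ℂ) * v n * s ^ 2 = t ^ 2 := by exact_mod_cast hs2
      linear_combination (-1 / 2 : ℂ) * this
    rw [e4, norm_mul, Complex.norm_natCast]
    have hb : ‖∫ x, (Complex.exp (((s * f n x : ℝ) : ℂ) * Complex.I) - 1
        - ((s * f n x : ℝ) : ℂ) * Complex.I + ((s * f n x : ℝ) : ℂ) ^ 2 / 2) ∂ρ n‖ ≤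
        ∫ x, |s| ^ 3 * C * f n x ^ 2 ∂ρ n := by
      refine norm_integral_le_of_norm_le Integrable.of_finite (ae_of_all _ fun x => ?_)
      refine (norm_exp_mul_I_sub_taylor_le (hx x)).trans ?_
      rw [abs_mul, mul_pow, mul_assoc]
      gcongr
      rw [pow_succ, sq_abs, mul_comm]
      gcongr
      exact hC n x
    rw [integral_const_mul, hvar] at hb
    calc (n : ℝ) * _ ≤ n * (|s| ^ 3 * C * v n) := by gcongr
      _ = |s| * (n * v n * |s| ^ 2 * C) := by ring
      _ = |s| * (t ^ 2 * C) := by rw [sq_abs, hs2]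
  simpa using Complex.tendsto_one_add_pow_exp_of_tendsto key

/-! ### Limits of pair sums and concentration of the union neighborhood. -/

section Sums

variable {P : ℕ → unitInterval} {i j : (n : ℕ) → Fin (n + 2)}

lemma tendsto_charFun_pairSum_normalized (hij : ∀ n, i n ≠ j n) {f : ℕ → (Bool → Prop) → ℝ}
    {v : ℕ → ℝ} {C : ℝ} (hC : ∀ n x, |f n x| ≤ C)
    (hmean : ∀ n, ∫ x, f n x ∂bernoulliPair (P n) = 0)
    (hvar : ∀ n, ∫ x, f n x ^ 2 ∂bernoulliPair (P n) = v n)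
    (hv : Tendsto (fun n : ℕ => n * v n) atTop atTop) (t : ℝ) :
    Tendsto (fun n : ℕ => charFun ((SimpleGraph.binomialRandom (Fin (n + 2)) (P n)).map
      (pairSum (i n) (j n) fun x => (√(n * v n))⁻¹ * f n x)) t)
      atTop (𝓝 (Complex.exp (-t ^ 2 / 2))) := by
  refine (tendsto_integral_exp_pow hC hmean hvar hv t).congr fun n => ?_
  rw [charFun_pairSum _ (hij n)]
  simp

/-- The hypothesis `hf` gives f the characteristic function of a Bernoulli(q) variable at t; then (1
+ q(exp(it) - 1))ⁿ converges because nq → r. -/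
lemma tendsto_charFun_pairSum_poisson (hij : ∀ n, i n ≠ j n) {f : (Bool → Prop) → ℝ}
    {q : ℕ → ℝ} {r t : ℝ}
    (hf : ∀ n, ∫ x, Complex.exp (t * f x * Complex.I) ∂bernoulliPair (P n) =
      1 + q n * (Complex.exp (t * Complex.I) - 1))
    (hq : Tendsto (fun n : ℕ => n * q n) atTop (𝓝 r)) :
    Tendsto (fun n : ℕ => charFun ((SimpleGraph.binomialRandom (Fin (n + 2)) (P n)).map
      (pairSum (i n) (j n) f)) t)
      atTop (𝓝 (Complex.exp (r * (Complex.exp (t * Complex.I) - 1)))) := by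
  have h : Tendsto (fun n : ℕ => (n : ℂ) * (q n * (Complex.exp (t * Complex.I) - 1))) atTop
      (𝓝 (r * (Complex.exp (t * Complex.I) - 1))) := by
    have h1 : Tendsto (fun n : ℕ => ((n * q n : ℝ) : ℂ)) atTop (𝓝 (r : ℂ)) :=
      (Complex.continuous_ofReal.tendsto r).comp hq
    refine (h1.mul_const (Complex.exp (t * Complex.I) - 1)).congr fun n => ?_
    push_cast
    ring
  refine (Complex.tendsto_one_add_pow_exp_of_tendsto h).congr fun n => ?_
  rw [charFun_pairSum _ (hij n), hf]
  simp

lemma integral_eitherInd (p : unitInterval) :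
    ∫ x, eitherInd x ∂bernoulliPair p = p * (2 - p) := by
  refine (integral_bothInd_eitherInd p fun _ b => b).trans ?_
  simp only [smul_eq_mul]
  ring

lemma variance_eitherInd_le (p : unitInterval) :
    Var[eitherInd; bernoulliPair p] ≤ p * (2 - p) := by
  refine (variance_le_expectation_sq Integrable.of_finite.aestronglyMeasurable).trans_eq ?_
  refine (integral_bothInd_eitherInd p fun _ b => b ^ 2).trans ?_
  simp only [smul_eq_mul]
  ring

/-- Chebyshev: the variance is at most the mean m = np(2-p), and m ≥ np, so the probability is at
most 1/(ε²np). -/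
lemma tendsto_measureReal_eitherInd (hij : ∀ n, i n ≠ j n)
    (hP : Tendsto (fun n : ℕ => n * (P n : ℝ)) atTop atTop) {ε : ℝ} (hε : 0 < ε) :
    Tendsto (fun n : ℕ => (SimpleGraph.binomialRandom (Fin (n + 2)) (P n)).real
      {G | ε ≤ |pairSum (i n) (j n) eitherInd G / (n * (P n * (2 - P n))) - 1|}) atTop (𝓝 0) := by
  have hlim : Tendsto (fun n : ℕ => (ε ^ 2)⁻¹ * (n * (P n : ℝ))⁻¹) atTop (𝓝 0) := by
    simpa using (tendsto_inv_atTop_zero.comp hP).const_mul (ε ^ 2)⁻¹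
  refine squeeze_zero' (Eventually.of_forall fun _ => measureReal_nonneg) ?_ hlim
  filter_upwards [hP.eventually_gt_atTop 0] with n hn
  set μ := SimpleGraph.binomialRandom (Fin (n + 2)) (P n)
  have hp1 : (P n : ℝ) ≤ 1 := (P n).2.2
  have hmle : (n : ℝ) * P n ≤ n * (P n * (2 - P n)) := by
    nlinarith
  set m : ℝ := n * (P n * (2 - P n)) with hm
  have hm0 : 0 < m := hn.trans_le hmle
  have hE : ∫ G, pairSum (i n) (j n) eitherInd G ∂μ = m := by
    rw [integral_pairSum _ (hij n), integral_eitherInd]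
    simp [hm]
  have hV : Var[pairSum (i n) (j n) eitherInd; μ] ≤ m := by
    rw [variance_pairSum _ (hij n)]
    have := variance_eitherInd_le (P n)
    simp only [Fintype.card_fin, Nat.add_sub_cancel, hm]
    gcongr
  have hset : {G | ε ≤ |pairSum (i n) (j n) eitherInd G / m - 1|} =
      {G | ε * m ≤ |pairSum (i n) (j n) eitherInd G - ∫ G, pairSum (i n) (j n) eitherInd G ∂μ|} := by
    ext G
    rw [hE, Set.mem_ofPred_eq, Set.mem_ofPred_eq, div_sub_one hm0.ne', abs_div, abs_of_pos hm0,
      le_div_iff₀ hm0]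
  have hcheb := meas_ge_le_variance_div_sq (μ := μ) (X := pairSum (i n) (j n) eitherInd)
    (memLp_of_finite _ _ _) (c := ε * m) (by positivity)
  rw [hset]
  calc μ.real _ ≤ Var[pairSum (i n) (j n) eitherInd; μ] / (ε * m) ^ 2 :=
        ENNReal.toReal_le_of_le_ofReal (div_nonneg (variance_nonneg _ _) (by positivity)) hcheb
    _ ≤ m / (ε * m) ^ 2 := by gcongr
    _ = (ε ^ 2)⁻¹ * m⁻¹ := by field_simp
    _ ≤ _ := by gcongr

end Sums

lemma tendstoInDistribution_of_mul_eq {Ω : ℕ → Type*} [∀ n, MeasurableSpace (Ω n)]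
    {μ : (n : ℕ) → Measure (Ω n)} [∀ n, IsProbabilityMeasure (μ n)]
    {Ω' : Type*} [MeasurableSpace Ω'] {ν : Measure Ω'} [IsProbabilityMeasure ν] {Z : Ω' → ℝ}
    {X Y U : (n : ℕ) → Ω n → ℝ} {a : ℕ → ℝ} {C : ℝ}
    (hXm : ∀ n, AEMeasurable (X n) (μ n)) (hYm : ∀ n, AEMeasurable (Y n) (μ n))
    (hZ : AEMeasurable Z ν)
    (hX : ∀ᶠ n in atTop, Integrable (X n) (μ n) ∧ ∫ ω, |X n ω| ∂μ n ≤ C)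
    (hU : ∀ ε : ℝ, 0 < ε → Tendsto (fun n => (μ n).real {ω | ε ≤ |U n ω - 1|}) atTop (𝓝 0))
    (ha : Tendsto a atTop (𝓝 1))
    (hYU : ∀ᶠ n in atTop, ∀ ω, U n ω ≠ 0 → Y n ω * U n ω = a n * X n ω)
    (h : ∀ t : ℝ, Tendsto (fun n => charFun ((μ n).map (X n)) t) atTop
      (𝓝 (charFun (ν.map Z) t))) :
    TendstoInDistribution Y atTop Z μ ν :=
  tendstoInDistribution_of_tendsto_charFun hYm hZ fun t =>
    tendsto_charFun_map_of_tendstoInProbability_sub hXm hYm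
      (fun _ hε => tendsto_measureReal_sub_of_mul_eq hX hU ha hYU hε) (h t)

/-! ### Passing between n and n + 2: with n + 2 vertices the sums have exactly n terms. -/

section Shift

variable {x : ℕ → ℝ}

lemma tendsto_natCast_mul_shift_atTop (hx : ∀ n, x n ≤ 1)
    (h : Tendsto (fun n : ℕ => n * x n) atTop atTop) :
    Tendsto (fun n : ℕ => n * x (n + 2)) atTop atTop := by
  have h2 := tendsto_atTop_add_const_right atTop (-2 : ℝ) (h.comp (tendsto_add_atTop_nat 2))
  refine tendsto_atTop_mono (fun n => ?_) h2
  simp only [Function.comp_apply]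
  push_cast
  linarith [hx (n + 2)]

lemma tendsto_zero_of_tendsto_natCast_mul {l : ℝ}
    (h : Tendsto (fun n : ℕ => n * x n) atTop (𝓝 l)) : Tendsto x atTop (𝓝 0) := by
  have h2 := h.mul (tendsto_inv_atTop_zero.comp tendsto_natCast_atTop_atTop)
  rw [mul_zero] at h2
  refine h2.congr' ?_
  filter_upwards [eventually_gt_atTop 0] with n hn
  have : (n : ℝ) ≠ 0 := by positivity
  simp only [Function.comp_apply]
  field_simp

lemma tendsto_natCast_mul_shift {l : ℝ} (h : Tendsto (fun n : ℕ => n * x n) atTop (𝓝 l)) :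
    Tendsto (fun n : ℕ => n * x (n + 2)) atTop (𝓝 l) := by
  have h0 := (tendsto_zero_of_tendsto_natCast_mul h).comp (tendsto_add_atTop_nat 2)
  have h2 := (h.comp (tendsto_add_atTop_nat 2)).sub (h0.const_mul 2)
  rw [mul_zero, sub_zero] at h2
  refine h2.congr fun n => ?_
  simp only [Function.comp_apply]
  push_cast
  ring

lemma tendsto_add_two_mul {l : ℝ} (h : Tendsto (fun n : ℕ => n * x n) atTop (𝓝 l)) :
    Tendsto (fun n : ℕ => ((n + 2 : ℕ) : ℝ) * x n) atTop (𝓝 l) := by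
  have h2 := h.add ((tendsto_zero_of_tendsto_natCast_mul h).const_mul 2)
  rw [mul_zero, add_zero] at h2
  refine h2.congr fun n => ?_
  push_cast
  ring

lemma tendsto_add_two_div : Tendsto (fun n : ℕ => ((n + 2 : ℕ) : ℝ) / n) atTop (𝓝 1) := by
  have h := ((tendsto_inv_atTop_zero.comp tendsto_natCast_atTop_atTop).const_mul (2 : ℝ)).const_add 1
  rw [mul_zero, add_zero] at h
  refine h.congr' ?_
  filter_upwards [eventually_gt_atTop 0] with n hn
  have : (n : ℝ) ≠ 0 := by positivity
  simp only [Function.comp_apply]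
  push_cast
  field_simp

end Shift

/-! ### Moments and characteristic functions of one summand. -/

section PairFunctions

lemma bothInd_nonneg (x : Bool → Prop) : 0 ≤ bothInd x := by
  unfold bothInd; split_ifs <;> norm_num

lemma eitherInd_le_one (x : Bool → Prop) : eitherInd x ≤ 1 := by
  unfold eitherInd; split_ifs <;> norm_num

lemma bothInd_le_eitherInd (x : Bool → Prop) : bothInd x ≤ eitherInd x := by
  unfold bothInd eitherInd
  split_ifs with h1 h2 <;> first | exact absurd (Or.inl h1.1) h2 | norm_num

variable (p : unitInterval)

lemma integral_bothInd : ∫ x, bothInd x ∂bernoulliPair p = (p : ℝ) ^ 2 := by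
  refine (integral_bothInd_eitherInd p fun a _ => a).trans ?_
  simp

lemma integral_eitherInd_sub_bothInd :
    ∫ x, (eitherInd x - bothInd x) ∂bernoulliPair p = 2 * (p : ℝ) * (1 - p) := by
  refine (integral_bothInd_eitherInd p fun a b => b - a).trans ?_
  simp

lemma integral_exp_bothInd (t : ℝ) :
    ∫ x, Complex.exp (t * bothInd x * Complex.I) ∂bernoulliPair p =
      1 + ((p : ℝ) ^ 2 : ℝ) * (Complex.exp (t * Complex.I) - 1) := by
  refine (integral_bothInd_eitherInd p fun a _ => Complex.exp (t * a * Complex.I)).trans ?_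
  simp only [Complex.real_smul, Complex.ofReal_one, Complex.ofReal_zero, mul_one, mul_zero,
    zero_mul, Complex.exp_zero]
  push_cast
  ring

lemma integral_exp_eitherInd_sub_bothInd (t : ℝ) :
    ∫ x, Complex.exp (t * (eitherInd x - bothInd x : ℝ) * Complex.I) ∂bernoulliPair p =
      1 + (2 * (p : ℝ) * (1 - p) : ℝ) * (Complex.exp (t * Complex.I) - 1) := by
  refine (integral_bothInd_eitherInd p fun a b => Complex.exp (t * (b - a : ℝ) * Complex.I)).trans ?_
  simp only [Complex.real_smul, Complex.ofReal_one, Complex.ofReal_zero, mul_one, mul_zero,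
    zero_mul, Complex.exp_zero, sub_self, sub_zero]
  push_cast
  ring

/-- The centred combination of the two indicators whose sum governs the fluctuations of the Jaccard
index. -/
noncomputable def jaccardDeviation (p : unitInterval) (x : Bool → Prop) : ℝ :=
  (2 - p) * bothInd x - p * eitherInd x

lemma abs_jaccardDeviation_le (x : Bool → Prop) : |jaccardDeviation p x| ≤ 2 := by
  have h0 : (0 : ℝ) ≤ p := p.2.1
  have h1 : (p : ℝ) ≤ 1 := p.2.2
  have h2 := bothInd_nonneg x
  have h3 := bothInd_le_eitherInd x
  have h4 := eitherInd_le_one x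
  unfold jaccardDeviation
  rw [abs_le]
  constructor <;> nlinarith

lemma integral_jaccardDeviation : ∫ x, jaccardDeviation p x ∂bernoulliPair p = 0 := by
  refine (integral_bothInd_eitherInd p fun a b => (2 - (p : ℝ)) * a - p * b).trans ?_
  simp only [smul_eq_mul]
  ring

lemma integral_jaccardDeviation_sq : ∫ x, jaccardDeviation p x ^ 2 ∂bernoulliPair p =
    2 * (p : ℝ) ^ 2 * (1 - p) * (2 - p) := by
  refine (integral_bothInd_eitherInd p fun a b => ((2 - (p : ℝ)) * a - p * b) ^ 2).trans ?_
  simp only [smul_eq_mul]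
  ring

end PairFunctions

/-! ### The five regimes. -/

section Limits

variable {P : ℕ → unitInterval} {i j : (n : ℕ) → Fin (n + 2)}

lemma pairSum_nonneg {V : Type*} [Fintype V] [DecidableEq V] {i j : V} {f : (Bool → Prop) → ℝ}
    (hf : ∀ x, 0 ≤ f x) (G : SimpleGraph V) : 0 ≤ pairSum i j f G :=
  Finset.sum_nonneg fun _ _ => hf _

lemma eventually_integral_abs_pairSum_le (hij : ∀ n, i n ≠ j n) {f : (Bool → Prop) → ℝ}
    (hf : ∀ x, 0 ≤ f x) {r : ℝ}
    (hr : Tendsto (fun n : ℕ => n * ∫ x, f x ∂bernoulliPair (P n)) atTop (𝓝 r)) :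
    ∀ᶠ n : ℕ in atTop,
      Integrable (pairSum (i n) (j n) f) (SimpleGraph.binomialRandom (Fin (n + 2)) (P n)) ∧
      ∫ G, |pairSum (i n) (j n) f G| ∂SimpleGraph.binomialRandom (Fin (n + 2)) (P n) ≤ r + 1 := by
  filter_upwards [hr.eventually_le_const (lt_add_one r)] with n hn
  refine ⟨Integrable.of_finite, ?_⟩
  simp_rw [abs_of_nonneg (pairSum_nonneg hf _)]
  rw [integral_pairSum _ (hij n)]
  simpa using hn

/-- The centred sum (2-p)S - pT equals (2-p)T(J - p/(2-p)), so after division by its standard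
deviation √(nv) it is the rescaled index times U, up to a scalar. -/
theorem tendstoInDistribution_jaccardIndex_gaussian (hij : ∀ n, i n ≠ j n)
    (h : Tendsto (fun n : ℕ => n * ((P n : ℝ) ^ 2 * (1 - P n))) atTop atTop) :
    TendstoInDistribution
      (fun (n : ℕ) (G : SimpleGraph (Fin (n + 2))) =>
        √(((n + 2 : ℕ) : ℝ) * (2 - (P n : ℝ)) ^ 3 / (2 * (1 - (P n : ℝ)))) *
          (jaccardIndex (P n) (i n) (j n) G - (P n : ℝ) / (2 - (P n : ℝ))))
      atTop (fun z : ℝ => z)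
      (fun n => SimpleGraph.binomialRandom (Fin (n + 2)) (P n)) (gaussianReal 0 1) := by
  have hp0 : ∀ n, (0 : ℝ) ≤ P n := fun n => (P n).2.1
  have hp1 : ∀ n, (P n : ℝ) ≤ 1 := fun n => (P n).2.2
  set v : ℕ → ℝ := fun n => 2 * (P n : ℝ) ^ 2 * (1 - P n) * (2 - P n) with hvdef
  have hPinf : Tendsto (fun n : ℕ => n * (P n : ℝ)) atTop atTop := by
    refine tendsto_atTop_mono (fun n => ?_) h
    refine mul_le_mul_of_nonneg_left ?_ n.cast_nonneg
    exact (mul_le_of_le_one_right (sq_nonneg _) (sub_le_self _ (hp0 n))).trans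
      (pow_le_of_le_one (hp0 n) (hp1 n) two_ne_zero)
  have hvinf : Tendsto (fun n : ℕ => n * v n) atTop atTop := by
    refine tendsto_atTop_mono (fun n => ?_) h
    simp only [hvdef]
    have h1 : 0 ≤ (P n : ℝ) ^ 2 * (1 - P n) := mul_nonneg (sq_nonneg _) (by linarith [hp1 n])
    refine mul_le_mul_of_nonneg_left ?_ n.cast_nonneg
    nlinarith [mul_nonneg h1 (sub_nonneg.mpr (hp1 n))]
  -- The scaling counts n + 2 vertices while the sum has n terms; this factor is the discrepancy.
  have ha : Tendsto (fun n : ℕ => √(((n + 2 : ℕ) : ℝ) / n)) atTop (𝓝 1) := by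
    have h2 := (Real.continuous_sqrt.tendsto 1).comp tendsto_add_two_div
    rw [Real.sqrt_one] at h2
    exact h2
  refine tendstoInDistribution_of_mul_eq
    (X := fun n => pairSum (i n) (j n) fun x => (√(n * v n))⁻¹ * jaccardDeviation (P n) x)
    (C := 2) (fun n => Measurable.of_discrete.aemeasurable)
    (fun n => Measurable.of_discrete.aemeasurable) aemeasurable_id ?_
    (fun ε hε => tendsto_measureReal_eitherInd hij hPinf hε) ha ?_ ?_
  · filter_upwards [hvinf.eventually_gt_atTop 0] with n hn
    refine ⟨Integrable.of_finite, ?_⟩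
    set μ := SimpleGraph.binomialRandom (Fin (n + 2)) (P n)
    set g : (Bool → Prop) → ℝ := fun x => (√(n * v n))⁻¹ * jaccardDeviation (P n) x with hg
    have hg0 : ∫ x, g x ∂bernoulliPair (P n) = 0 := by
      simp only [hg]
      rw [integral_const_mul, integral_jaccardDeviation, mul_zero]
    have hX0 : ∫ G, pairSum (i n) (j n) g G ∂μ = 0 := by
      rw [integral_pairSum _ (hij n), hg0, mul_zero]
    have hX2 : ∫ G, pairSum (i n) (j n) g G ^ 2 ∂μ = 1 := by
      rw [← variance_of_integral_eq_zero Measurable.of_discrete.aemeasurable hX0,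
        variance_pairSum _ (hij n),
        variance_of_integral_eq_zero Measurable.of_discrete.aemeasurable hg0]
      simp only [hg, mul_pow]
      rw [integral_const_mul, integral_jaccardDeviation_sq, inv_pow, Real.sq_sqrt hn.le]
      simp only [Fintype.card_fin, Nat.add_sub_cancel]
      change (n : ℝ) * ((n * v n)⁻¹ * v n) = 1
      rw [mul_left_comm, inv_mul_cancel₀ hn.ne']
    -- Since |x| ≤ 1 + x² and the normalized sum has second moment 1, the L¹ bound is 2.
    calc ∫ G, |pairSum (i n) (j n) g G| ∂μ ≤ ∫ G, (1 + pairSum (i n) (j n) g G ^ 2) ∂μ := by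
          refine integral_mono Integrable.of_finite Integrable.of_finite fun G => ?_
          rw [← sq_abs (pairSum (i n) (j n) g G)]
          nlinarith [sq_nonneg (|pairSum (i n) (j n) g G| - 1), abs_nonneg (pairSum (i n) (j n) g G)]
      _ = 2 := by
          rw [integral_add (integrable_const _) Integrable.of_finite, hX2]
          simp
          norm_num
  · filter_upwards [h.eventually_gt_atTop 0, hvinf.eventually_gt_atTop 0] with n hn hnv G hG
    have hn0 : 0 < (n : ℝ) := by
      rcases Nat.eq_zero_or_pos n with h | h
      · simp [h] at hn
      · exact_mod_cast h
    have hpos : 0 < (P n : ℝ) ^ 2 * (1 - P n) := pos_of_mul_pos_right hn hn0.le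
    have hppos : 0 < (P n : ℝ) := by
      rcases (hp0 n).eq_or_lt with h | h
      · simp [← h] at hpos
      · exact h
    have hp1pos : 0 < 1 - (P n : ℝ) := pos_of_mul_pos_right hpos (sq_nonneg _)
    have hT : pairSum (i n) (j n) eitherInd G ≠ 0 := fun h => hG (by simp [h])
    have hJ := jaccardIndex_mul_pairSum (P n) G hT
    simp only [pairSum_const_mul]
    have hW : pairSum (i n) (j n) (jaccardDeviation (P n)) G =
        (2 - P n) * pairSum (i n) (j n) bothInd G - P n * pairSum (i n) (j n) eitherInd G := by
      unfold jaccardDeviation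
      rw [pairSum_sub, pairSum_const_mul, pairSum_const_mul]
    have h2p : 0 < 2 - (P n : ℝ) := by linarith
    have hsq : √(((n + 2 : ℕ) : ℝ) * (2 - (P n : ℝ)) ^ 3 / (2 * (1 - (P n : ℝ)))) =
        √(((n + 2 : ℕ) : ℝ) / n) * (√(n * v n))⁻¹ * (n * P n * (2 - P n) ^ 2) := by
      rw [← Real.sqrt_sq (show 0 ≤ √(((n + 2 : ℕ) : ℝ) / n) * (√(n * v n))⁻¹ *
        (n * P n * (2 - P n) ^ 2) by positivity)]
      congr 1
      rw [mul_pow, mul_pow, inv_pow, Real.sq_sqrt hnv.le, Real.sq_sqrt (by positivity)]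
      simp only [hvdef]
      field_simp
    rw [hW, hsq, ← hJ]
    field_simp
  · intro t
    refine (tendsto_charFun_pairSum_normalized hij (fun n x => abs_jaccardDeviation_le (P n) x)
      (fun n => integral_jaccardDeviation (P n)) (fun n => integral_jaccardDeviation_sq (P n))
      hvinf t).trans_eq ?_
    have : (gaussianReal 0 1).map (fun z : ℝ => z) = gaussianReal 0 1 := Measure.map_id
    rw [this, charFun_gaussianReal]
    congr 2
    simp [neg_div]

/-- Here p → 0, so T is close to 2np and 2npJ is close to S, a sum of n Bernoulli(p²) variables. -/
theorem tendstoInDistribution_jaccardIndex_sparse (hij : ∀ n, i n ≠ j n) {l : ℝ≥0} (hl : 0 < l)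
    (h : Tendsto (fun n : ℕ => n * (P n : ℝ) ^ 2) atTop (𝓝 (l : ℝ))) :
    TendstoInDistribution
      (fun (n : ℕ) (G : SimpleGraph (Fin (n + 2))) =>
        2 * ((n + 2 : ℕ) : ℝ) * (P n : ℝ) * jaccardIndex (P n) (i n) (j n) G)
      atTop (fun k : ℕ => (k : ℝ))
      (fun n => SimpleGraph.binomialRandom (Fin (n + 2)) (P n)) (poissonMeasure l) := by
  have hp0 : ∀ n, (0 : ℝ) ≤ P n := fun n => (P n).2.1
  have hp1 : ∀ n, (P n : ℝ) ≤ 1 := fun n => (P n).2.2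
  have hl' : (0 : ℝ) < l := hl
  -- np = √(n · np²), which diverges because the limit l of np² is positive.
  have hPinf : Tendsto (fun n : ℕ => n * (P n : ℝ)) atTop atTop := by
    refine (Real.tendsto_sqrt_atTop.comp
      (tendsto_natCast_atTop_atTop.atTop_mul_pos hl' h)).congr fun n => ?_
    simp only [Function.comp_apply]
    rw [show (n : ℝ) * (n * (P n : ℝ) ^ 2) = (n * P n) ^ 2 by ring,
      Real.sqrt_sq (mul_nonneg n.cast_nonneg (hp0 n))]
  have hP0 : Tendsto (fun n => (P n : ℝ)) atTop (𝓝 0) := by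
    have h2 := (Real.continuous_sqrt.tendsto 0).comp (tendsto_zero_of_tendsto_natCast_mul h)
    rw [Real.sqrt_zero] at h2
    exact h2.congr fun n => Real.sqrt_sq (hp0 n)
  have ha : Tendsto (fun n : ℕ => ((n + 2 : ℕ) : ℝ) / n * (2 / (2 - P n))) atTop (𝓝 1) := by
    have h2 : Tendsto (fun n : ℕ => (2 : ℝ) / (2 - P n)) atTop (𝓝 (2 / (2 - 0))) :=
      tendsto_const_nhds.div (hP0.const_sub 2) (by norm_num)
    have h3 := tendsto_add_two_div.mul h2
    norm_num at h3
    simpa using h3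
  refine tendstoInDistribution_of_mul_eq (X := fun n => pairSum (i n) (j n) bothInd)
    (fun n => Measurable.of_discrete.aemeasurable) (fun n => Measurable.of_discrete.aemeasurable)
    Measurable.of_discrete.aemeasurable
    (eventually_integral_abs_pairSum_le hij bothInd_nonneg (by simpa [integral_bothInd] using h))
    (fun ε hε => tendsto_measureReal_eitherInd hij hPinf hε) ha ?_ ?_
  · filter_upwards [hPinf.eventually_gt_atTop 0] with n hn G hG
    have hn0 : (n : ℝ) ≠ 0 := left_ne_zero_of_mul hn.ne'
    have hpne : (P n : ℝ) ≠ 0 := right_ne_zero_of_mul hn.ne'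
    have h2p : 2 - (P n : ℝ) ≠ 0 := by linarith [hp1 n]
    have hT : pairSum (i n) (j n) eitherInd G ≠ 0 := fun h => hG (by simp [h])
    rw [← jaccardIndex_mul_pairSum (P n) G hT]
    field_simp
  · intro t
    rw [charFun_map_cast_poissonMeasure]
    exact tendsto_charFun_pairSum_poisson hij (fun n => integral_exp_bothInd (P n) t) h

/-- T - S counts the vertices adjacent to exactly one of i and j, each with probability 2p(1-p). As
p → 1, T is close to n, so n(1 - J) is close to T - S. -/
theorem tendstoInDistribution_jaccardIndex_dense (hij : ∀ n, i n ≠ j n) {c : ℝ≥0}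
    (h : Tendsto (fun n : ℕ => n * (1 - (P n : ℝ))) atTop (𝓝 (c : ℝ))) :
    TendstoInDistribution
      (fun (n : ℕ) (G : SimpleGraph (Fin (n + 2))) =>
        ((n + 2 : ℕ) : ℝ) * (1 - jaccardIndex (P n) (i n) (j n) G))
      atTop (fun k : ℕ => (k : ℝ))
      (fun n => SimpleGraph.binomialRandom (Fin (n + 2)) (P n)) (poissonMeasure (2 * c)) := by
  have hp1 : ∀ n, (P n : ℝ) ≤ 1 := fun n => (P n).2.2
  have hP1 : Tendsto (fun n => (P n : ℝ)) atTop (𝓝 1) := by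
    have h2 := (tendsto_zero_of_tendsto_natCast_mul h).const_sub 1
    simpa using h2
  have hPinf : Tendsto (fun n : ℕ => n * (P n : ℝ)) atTop atTop :=
    tendsto_natCast_atTop_atTop.atTop_mul_pos one_pos hP1
  have ha : Tendsto (fun n : ℕ => ((n + 2 : ℕ) : ℝ) / n * (1 / (P n * (2 - P n)))) atTop
      (𝓝 1) := by
    have h2 : Tendsto (fun n : ℕ => (1 : ℝ) / (P n * (2 - P n))) atTop (𝓝 (1 / (1 * (2 - 1)))) :=
      tendsto_const_nhds.div (hP1.mul (hP1.const_sub 2)) (by norm_num)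
    have h3 := tendsto_add_two_div.mul h2
    norm_num at h3
    simpa using h3
  have hq : Tendsto (fun n : ℕ => n * (2 * (P n : ℝ) * (1 - P n))) atTop (𝓝 (2 * c : ℝ≥0)) := by
    have h2 := (h.mul hP1).const_mul 2
    rw [mul_one] at h2
    push_cast
    exact h2.congr fun n => by ring
  refine tendstoInDistribution_of_mul_eq
    (X := fun n => pairSum (i n) (j n) fun x => eitherInd x - bothInd x)
    (fun n => Measurable.of_discrete.aemeasurable) (fun n => Measurable.of_discrete.aemeasurable)
    Measurable.of_discrete.aemeasurable
    (eventually_integral_abs_pairSum_le hij (fun x => sub_nonneg.mpr (bothInd_le_eitherInd x))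
      (by simpa only [integral_eitherInd_sub_bothInd] using hq))
    (fun ε hε => tendsto_measureReal_eitherInd hij hPinf hε) ha ?_ ?_
  · filter_upwards [hPinf.eventually_gt_atTop 0] with n hn G hG
    have hn0 : (n : ℝ) ≠ 0 := left_ne_zero_of_mul hn.ne'
    have hpne : (P n : ℝ) ≠ 0 := right_ne_zero_of_mul hn.ne'
    have h2p : 2 - (P n : ℝ) ≠ 0 := by linarith [hp1 n]
    have hT : pairSum (i n) (j n) eitherInd G ≠ 0 := fun h => hG (by simp [h])
    rw [pairSum_sub, ← jaccardIndex_mul_pairSum (P n) G hT]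
    field_simp
  · intro t
    rw [charFun_map_cast_poissonMeasure]
    exact tendsto_charFun_pairSum_poisson hij
      (fun n => integral_exp_eitherInd_sub_bothInd (P n) t) hq

/-- Markov bounds the probability that the sum reaches 1 by its vanishing mean; off that event Y is
bounded by b → 0. For counts, being below 1 means being 0. No concentration of T is needed, so np
may stay bounded. -/
lemma tendstoInProbability_zero_of_pairSum (hij : ∀ n, i n ≠ j n) {f : (Bool → Prop) → ℝ}
    (hf : ∀ x, 0 ≤ f x)
    (hq : Tendsto (fun n : ℕ => n * ∫ x, f x ∂bernoulliPair (P n)) atTop (𝓝 0))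
    {Y : (n : ℕ) → SimpleGraph (Fin (n + 2)) → ℝ} {b : ℕ → ℝ} (hb : Tendsto b atTop (𝓝 0))
    (hY : ∀ n G, pairSum (i n) (j n) f G < 1 → |Y n G| ≤ b n) :
    TendstoInProbability Y (fun n => SimpleGraph.binomialRandom (Fin (n + 2)) (P n)) 0 := by
  refine ⟨fun n => Measurable.of_discrete.aemeasurable, fun ε hε => ?_⟩
  refine squeeze_zero' (Eventually.of_forall fun _ => measureReal_nonneg) ?_ hq
  filter_upwards [hb.eventually_lt_const hε] with n hn
  have hsub : {G | ε ≤ |Y n G - 0|} ⊆ {G | 1 ≤ pairSum (i n) (j n) f G} := by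
    intro G hG
    rw [Set.mem_ofPred_eq, sub_zero] at hG
    by_contra hcon
    exact (hG.trans (hY n G (not_le.mp hcon))).not_gt hn
  have hmark := mul_meas_ge_le_integral_of_nonneg
    (μ := SimpleGraph.binomialRandom (Fin (n + 2)) (P n)) (f := pairSum (i n) (j n) f)
    (ae_of_all _ (pairSum_nonneg hf)) Integrable.of_finite 1
  rw [integral_pairSum _ (hij n), one_mul] at hmark
  refine (measureReal_mono hsub).trans (hmark.trans_eq ?_)
  simp

theorem tendstoInProbability_jaccardIndex_sparse (hij : ∀ n, i n ≠ j n)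
    (h : Tendsto (fun n : ℕ => n * (P n : ℝ) ^ 2) atTop (𝓝 0)) :
    TendstoInProbability
      (fun (n : ℕ) (G : SimpleGraph (Fin (n + 2))) =>
        ((n + 2 : ℕ) : ℝ) * (P n : ℝ) * jaccardIndex (P n) (i n) (j n) G)
      (fun n => SimpleGraph.binomialRandom (Fin (n + 2)) (P n)) 0 := by
  refine tendstoInProbability_zero_of_pairSum hij bothInd_nonneg
    (by simpa [integral_bothInd] using h) (tendsto_add_two_mul h) fun n G hG => ?_
  have hp0 : (0 : ℝ) ≤ P n := (P n).2.1
  have hp1 : (P n : ℝ) ≤ 1 := (P n).2.2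
  by_cases hT : pairSum (i n) (j n) eitherInd G = 0
  · rw [jaccardIndex_of_pairSum_eq_zero _ _ hT]
    -- With T = 0 the index takes its default value, at most p, so the scaled index is at most (n +
    -- 2)p² → 0.
    have h2 : (P n : ℝ) / (2 - P n) ≤ P n := div_le_self hp0 (by linarith)
    have h3 : 0 ≤ (P n : ℝ) / (2 - P n) := div_nonneg hp0 (by linarith)
    rw [abs_of_nonneg (by positivity), sq, ← mul_assoc]
    gcongr
  · have hJ := jaccardIndex_mul_pairSum (P n) G hT
    have hS : pairSum (i n) (j n) bothInd G = 0 := by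
      rw [pairSum_bothInd] at hG ⊢
      have : ((G.commonNeighbors (i n) (j n)).ncard) < 1 := by exact_mod_cast hG
      exact_mod_cast Nat.lt_one_iff.mp this
    rw [hS] at hJ
    rw [(mul_eq_zero.mp hJ).resolve_right hT, mul_zero, abs_zero]
    positivity

theorem tendstoInProbability_jaccardIndex_dense (hij : ∀ n, i n ≠ j n)
    (h : Tendsto (fun n : ℕ => n * (1 - (P n : ℝ))) atTop (𝓝 0)) :
    TendstoInProbability
      (fun (n : ℕ) (G : SimpleGraph (Fin (n + 2))) =>
        ((n + 2 : ℕ) : ℝ) * (1 - jaccardIndex (P n) (i n) (j n) G))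
      (fun n => SimpleGraph.binomialRandom (Fin (n + 2)) (P n)) 0 := by
  have hp0 : ∀ n, (0 : ℝ) ≤ P n := fun n => (P n).2.1
  have hp1 : ∀ n, (P n : ℝ) ≤ 1 := fun n => (P n).2.2
  have hb : Tendsto (fun n : ℕ => 2 * (((n + 2 : ℕ) : ℝ) * (1 - (P n : ℝ)))) atTop (𝓝 0) := by
    simpa only [mul_zero] using (tendsto_add_two_mul h).const_mul 2
  have hD : ∀ x, 0 ≤ eitherInd x - bothInd x := fun x => sub_nonneg.mpr (bothInd_le_eitherInd x)
  refine tendstoInProbability_zero_of_pairSum hij hD ?_ hb fun n G hG => ?_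
  · simp only [integral_eitherInd_sub_bothInd]
    have hb2 : Tendsto (fun n : ℕ => 2 * ((n : ℝ) * (1 - (P n : ℝ)))) atTop (𝓝 0) := by
      simpa only [mul_zero] using h.const_mul 2
    refine squeeze_zero (fun n => ?_) (fun n => ?_) hb2
    · have := hp0 n
      have : 0 ≤ 1 - (P n : ℝ) := sub_nonneg.mpr (hp1 n)
      positivity
    · have h1 : 0 ≤ (n : ℝ) * (1 - (P n : ℝ)) :=
        mul_nonneg n.cast_nonneg (sub_nonneg.mpr (hp1 n))
      nlinarith [mul_le_mul_of_nonneg_left (hp1 n) h1]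
  have h1p : 0 ≤ 1 - (P n : ℝ) := sub_nonneg.mpr (hp1 n)
  by_cases hT : pairSum (i n) (j n) eitherInd G = 0
  · rw [jaccardIndex_of_pairSum_eq_zero _ _ hT]
    have h2p : 1 ≤ 2 - (P n : ℝ) := by linarith [hp1 n]
    -- The default value differs from 1 by at most 2(1 - p), which is where the factor 2 in `hb`
    -- comes from.
    have h2 : 1 - (P n : ℝ) / (2 - P n) = 2 * (1 - P n) / (2 - P n) := by
      field_simp
      ring
    have h3 : 2 * (1 - (P n : ℝ)) / (2 - P n) ≤ 2 * (1 - P n) := div_le_self (by positivity) h2p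
    have h4 : 0 ≤ 2 * (1 - (P n : ℝ)) / (2 - P n) := by positivity
    rw [h2, abs_of_nonneg (by positivity), mul_left_comm]
    gcongr
  · have hJ := jaccardIndex_mul_pairSum (P n) G hT
    have hS : pairSum (i n) (j n) bothInd G = pairSum (i n) (j n) eitherInd G := by
      have h0 := pairSum_nonneg (i := i n) (j := j n) hD G
      rw [pairSum_sub, pairSum_bothInd, pairSum_eitherInd] at hG h0
      rw [pairSum_bothInd, pairSum_eitherInd]
      have h1 : (G.unionNeighbors (i n) (j n)).ncard <
          (G.commonNeighbors (i n) (j n)).ncard + 1 := by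
        have : ((G.unionNeighbors (i n) (j n)).ncard : ℝ) <
          (G.commonNeighbors (i n) (j n)).ncard + 1 := by linarith
        exact_mod_cast this
      have h2 : (G.commonNeighbors (i n) (j n)).ncard ≤ (G.unionNeighbors (i n) (j n)).ncard := by
        have := sub_nonneg.mp h0
        exact_mod_cast this
      congr 1
      omega
    rw [hS] at hJ
    rw [(mul_eq_right₀ hT).mp hJ, sub_self, mul_zero, abs_zero]
    positivity

end Limits

/-- The random graphs are `G(m, p m)` on the vertex sets `Fin m` for `m = n + 2 ≥ 2`, and
`i n`, `j n` are arbitrary distinct vertices of the graph on `n + 2` vertices. -/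
theorem theorem2p1 (p : ℕ → unitInterval) (i j : (n : ℕ) → Fin (n + 2))
    (hij : ∀ n, i n ≠ j n) :
    -- asymptotic normality
    (Tendsto (fun n : ℕ => (n : ℝ) * (p n : ℝ) ^ 2 * (1 - (p n : ℝ))) atTop atTop →
      TendstoInDistribution
        (fun (n : ℕ) (G : SimpleGraph (Fin (n + 2))) =>
          √(((n + 2 : ℕ) : ℝ) * (2 - (p (n + 2) : ℝ)) ^ 3 / (2 * (1 - (p (n + 2) : ℝ)))) *
            (jaccardIndex (p (n + 2)) (i n) (j n) G
              - (p (n + 2) : ℝ) / (2 - (p (n + 2) : ℝ))))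
        atTop (fun z : ℝ => z)
        (fun n => SimpleGraph.binomialRandom (Fin (n + 2)) (p (n + 2))) (gaussianReal 0 1)) ∧
    -- Poisson limit in the sparse critical regime
    (∀ l : ℝ≥0, 0 < l → Tendsto (fun n : ℕ => (n : ℝ) * (p n : ℝ) ^ 2) atTop (𝓝 (l : ℝ)) →
      TendstoInDistribution
        (fun (n : ℕ) (G : SimpleGraph (Fin (n + 2))) =>
          2 * ((n + 2 : ℕ) : ℝ) * (p (n + 2) : ℝ) * jaccardIndex (p (n + 2)) (i n) (j n) G)
        atTop (fun k : ℕ => (k : ℝ))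
        (fun n => SimpleGraph.binomialRandom (Fin (n + 2)) (p (n + 2))) (poissonMeasure l)) ∧
    -- degenerate limit in the sparse regime
    (Tendsto (fun n : ℕ => (n : ℝ) * (p n : ℝ) ^ 2) atTop (𝓝 0) →
      TendstoInProbability
        (fun (n : ℕ) (G : SimpleGraph (Fin (n + 2))) =>
          ((n + 2 : ℕ) : ℝ) * (p (n + 2) : ℝ) * jaccardIndex (p (n + 2)) (i n) (j n) G)
        (fun n => SimpleGraph.binomialRandom (Fin (n + 2)) (p (n + 2))) 0) ∧
    -- Poisson limit in the dense critical regime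
    (∀ c : ℝ≥0, 0 < c → Tendsto (fun n : ℕ => (n : ℝ) * (1 - (p n : ℝ))) atTop (𝓝 (c : ℝ)) →
      TendstoInDistribution
        (fun (n : ℕ) (G : SimpleGraph (Fin (n + 2))) =>
          ((n + 2 : ℕ) : ℝ) * (1 - jaccardIndex (p (n + 2)) (i n) (j n) G))
        atTop (fun k : ℕ => (k : ℝ))
        (fun n => SimpleGraph.binomialRandom (Fin (n + 2)) (p (n + 2)))
        (poissonMeasure (2 * c))) ∧
    -- degenerate limit in the dense regime
    (Tendsto (fun n : ℕ => (n : ℝ) * (1 - (p n : ℝ))) atTop (𝓝 0) →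
      TendstoInProbability
        (fun (n : ℕ) (G : SimpleGraph (Fin (n + 2))) =>
          ((n + 2 : ℕ) : ℝ) * (1 - jaccardIndex (p (n + 2)) (i n) (j n) G))
        (fun n => SimpleGraph.binomialRandom (Fin (n + 2)) (p (n + 2))) 0) := by
  exact
    ⟨fun h => tendstoInDistribution_jaccardIndex_gaussian hij
      (tendsto_natCast_mul_shift_atTop (x := fun n => (p n : ℝ) ^ 2 * (1 - p n))
        (fun n => mul_le_one₀ (pow_le_one₀ (p n).2.1 (p n).2.2) (sub_nonneg.mpr (p n).2.2)
          (sub_le_self _ (p n).2.1))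
        (h.congr fun n => mul_assoc _ _ _)),
    fun _ hl h => tendstoInDistribution_jaccardIndex_sparse hij hl
      (tendsto_natCast_mul_shift (x := fun n => (p n : ℝ) ^ 2) h),
    fun h => tendstoInProbability_jaccardIndex_sparse hij
      (tendsto_natCast_mul_shift (x := fun n => (p n : ℝ) ^ 2) h),
    fun _ _ h => tendstoInDistribution_jaccardIndex_dense hij
      (tendsto_natCast_mul_shift (x := fun n => 1 - (p n : ℝ)) h),
    fun h => tendstoInProbability_jaccardIndex_dense hij
      (tendsto_natCast_mul_shift (x := fun n => 1 - (p n : ℝ)) h)⟩
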